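/- Let $p$ be a prime, let $K$ be a finite extension of $\mathbf{Q}_p$ with valuation ring $\mathfrak{O}$, let $\mathfrak{P}$ be the maximal ideal of $\mathfrak{O}$, and write $\mathfrak{O}_n = \mathfrak{O}/\mathfrak{P}^n$ for $n \ge 0$. Matrices act on row vectors by right multiplication. *Ask zeta functions.* For finitely generated $\mathfrak{O}$-modules $V, W$ and a submodule $M \subset \operatorname{Hom}(V,W)$, let $M_n$ be the image of $M$ under $\operatorname{Hom}(V,W) \to \operatorname{Hom}(V\otimes\mathfrak{O}_n, W\otimes\mathfrak{O}_n)$, $a \mapsto a\otimes\mathrm{id}$, and put $$\mathsf{Z}_M(T) = \mathsf{Z}^{\mathsf{ask}}_M(T) = \sum_{n=0}^\infty \Bigl(\frac{1}{|M_n|}\sum_{a\in M_n}|\operatorname{Ker}(a)|\Bigr)T^n \in \mathbf{Q}[\![T]\!].$$ A module of $d\times e$ matrices over $\mathfrak{O}$ is regarded as a submodule of $\operatorname{Hom}(\mathfrak{O}^d,\mathfrak{O}^e)$. For a Lie algebra $\mathfrak{g}$, let $\operatorname{ad}(\mathfrak{g}) \subset \operatorname{Hom}(\mathfrak{g},\mathfrak{g})$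 be the module of all maps $\operatorname{ad}(a)\colon b\mapsto [b,a]$ with $a\in\mathfrak{g}$. *Group zeta functions.* For a subgroup $G \le \operatorname{GL}_d(\mathfrak{O})$, let $G_n$ be its image in $\operatorname{GL}_d(\mathfrak{O}_n)$, and let $k(G_n)$ be the number of conjugacy classes of $G_n$. The orbit-counting and conjugacy class zeta functions of $G$ are $$\mathsf{Z}^{\mathsf{oc}}_G(T) = \sum_{n=0}^\infty |\mathfrak{O}_n^d/G|\,T^n, \qquad \mathsf{Z}^{\mathsf{cc}}_G(T) = \sum_{n=0}^\infty k(G_n)\,T^n.$$ **Theorem.** Let $\mathfrak{n}_d(\mathfrak{O})$ be the Lie algebra of strictly upper triangular $d\times d$ matrices over $\mathfrak{O}$ and let $\mathfrak{g}\subset\mathfrak{n}_d(\mathfrak{O})$ be a Lie subalgebra (over $\mathfrak{O}$). Suppose that $p \ge d$ and that $\mathfrak{g}$ is isolated in $\mathfrak{n}_d(\mathfrak{O})$, i.e. that the $\mathfrak{O}$-module $\mathfrak{n}_d(\mathfrak{O})/\mathfrak{g}$ is torsion-free. Then $G := \exp(\mathfrak{g})$, where $\exp(a)=\sum_{i\ge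 0} a^i/i!$, is a subgroup of $\operatorname{GL}_d(\mathfrak{O})$ consisting of upper unitriangular matrices, and $$\mathsf{Z}^{\mathsf{oc}}_G(T) = \mathsf{Z}^{\mathsf{ask}}_{\mathfrak{g}}(T) \qquad\text{and}\qquad \mathsf{Z}^{\mathsf{cc}}_G(T) = \mathsf{Z}^{\mathsf{ask}}_{\operatorname{ad}(\mathfrak{g})}(T).$$ -/

import Mathlib

open scoped TensorProduct

/- Associative rings carry the commutator bracket `⁅a, b⁆ = a * b - b * a`. -/
attribute [local instance] LieRing.ofAssociativeRing

noncomputable section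

namespace AskZeta

/-! ### The valuation ring of a finite extension of `ℚ_p` -/

section ValuationRing

variable (p : ℕ) [Fact p.Prime] (K : Type*) [Field K] [Algebra ℚ_[p] K]
  [FiniteDimensional ℚ_[p] K]

/-- The valuation ring of the finite extension `K` of `ℚ_[p]`: the closed unit ball of
`spectralNorm ℚ_[p] K`, the unique absolute value on `K` extending the `p`-adic one. -/
def valuationRing : ValuationSubring K where
  carrier := {x | spectralNorm ℚ_[p] K x ≤ 1}
  mul_mem' := by
    intro x y hx hy
    have h : spectralNorm ℚ_[p] K (x * y) = _ := map_mul (spectralMulAlgNorm ℚ_[p] K) x y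
    simp only [spectralMulAlgNorm_def] at h
    rw [Set.mem_ofPred_eq, h]
    exact mul_le_one₀ hx (spectralNorm_nonneg y) hy
  one_mem' := (spectralNorm_one (K := ℚ_[p]) (L := K)).le
  add_mem' := by
    intro x y hx hy
    exact (isNonarchimedean_spectralNorm (K := ℚ_[p]) (L := K) x y).trans (max_le hx hy)
  zero_mem' := by
    simp only [Set.mem_ofPred_eq, spectralNorm_zero, zero_le_one]
  neg_mem' := by
    intro x hx
    rw [Set.mem_ofPred_eq, spectralNorm_neg (Algebra.IsAlgebraic.isAlgebraic x)]
    exact hx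
  mem_or_inv_mem' := by
    intro x
    have h : spectralNorm ℚ_[p] K x⁻¹ = _ := map_inv₀ (spectralMulAlgNorm ℚ_[p] K) x
    simp only [spectralMulAlgNorm_def] at h
    rcases le_total (spectralNorm ℚ_[p] K x) 1 with hx | hx
    · exact Or.inl hx
    · refine Or.inr ?_
      simp only [Set.mem_ofPred_eq]
      rw [h]
      exact inv_le_one_of_one_le₀ hx

/-- The exponential `∑ aⁱ / i!` of a nilpotent square matrix over `K`. -/
def matrixExp {n : Type*} [Fintype n] [DecidableEq n] (a : Matrix n n K) : Matrix n n K :=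
  haveI : CharZero K := charZero_of_injective_algebraMap (algebraMap ℚ_[p] K).injective
  IsNilpotent.exp a

end ValuationRing

/-! ### Average sizes of kernels and ask zeta functions -/

/-- The average size of the kernel of the elements of a (finite) module `M` of linear maps
`V → W`. -/
def ask {R V W : Type*} [CommRing R] [AddCommGroup V] [Module R V] [AddCommGroup W] [Module R W]
    (M : Submodule R (V →ₗ[R] W)) : ℚ :=
  (Nat.card M : ℚ)⁻¹ * ∑ᶠ a : M, (Nat.card (LinearMap.ker (a : V →ₗ[R] W)) : ℚ)

section Local

variable {R : Type*} [CommRing R] [IsLocalRing R]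

/-- `R / 𝔓ⁿ`, where `𝔓` is the maximal ideal of the local ring `R`. -/
abbrev Quot (R : Type*) [CommRing R] [IsLocalRing R] (n : ℕ) : Type _ :=
  R ⧸ (IsLocalRing.maximalIdeal R ^ n)

/-- The image of `M ⊆ Hom(V, W)` under
`Hom(V, W) → Hom(V ⊗ R/𝔓ⁿ, W ⊗ R/𝔓ⁿ)`, `a ↦ a ⊗ id`. (Maps between `R/𝔓ⁿ`-modules are
`R/𝔓ⁿ`-linear if and only if they are `R`-linear.) -/
def reduction {V W : Type*} [AddCommGroup V] [Module R V] [AddCommGroup W] [Module R W]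
    (M : Submodule R (V →ₗ[R] W)) (n : ℕ) :
    Submodule R (V ⊗[R] Quot R n →ₗ[R] W ⊗[R] Quot R n) :=
  M.map (LinearMap.rTensorHom (Quot R n))

/-- The ask zeta function `∑ ask(Mₙ) Tⁿ` of `M ⊆ Hom(V, W)`. -/
def askZeta {V W : Type*} [AddCommGroup V] [Module R V] [AddCommGroup W] [Module R W]
    (M : Submodule R (V →ₗ[R] W)) : PowerSeries ℚ :=
  PowerSeries.mk fun n => ask (reduction M n)

/-- The `R`-linear map sending a matrix `a` to the map `x ↦ x a` on row vectors. -/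
def rowAction (R : Type*) [CommRing R] (d e : ℕ) :
    Matrix (Fin d) (Fin e) R →ₗ[R] ((Fin d → R) →ₗ[R] (Fin e → R)) where
  toFun a := a.vecMulLinear
  map_add' a b := by
    ext1 x
    ext j
    simp
  map_smul' c a := by
    ext1 x
    ext j
    simp

/-- The ask zeta function of a module of `d × e` matrices, acting on row vectors by right
multiplication. -/
def matrixAskZeta {d e : ℕ} (M : Submodule R (Matrix (Fin d) (Fin e) R)) : PowerSeries ℚ :=
  askZeta (M.map (rowAction R d e))

/-! ### Orbit-counting and conjugacy class zeta functions -/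

/-- The image `Gₙ` of `G ≤ GL_d(R)` in `GL_d(R/𝔓ⁿ)`. -/
def congruenceImage {d : ℕ} (G : Subgroup (GL (Fin d) R)) (n : ℕ) :
    Subgroup (GL (Fin d) (Quot R n)) :=
  G.map (Matrix.GeneralLinearGroup.map (Ideal.Quotient.mk (IsLocalRing.maximalIdeal R ^ n)))

/-- The partition of the row vectors `S^d` into orbits of `H ≤ GL_d(S)` acting by right
multiplication. -/
def orbitSetoid {S : Type*} [CommRing S] {d : ℕ} (H : Subgroup (GL (Fin d) S)) :
    Setoid (Fin d → S) where
  r x y := ∃ h ∈ H, Matrix.vecMul x (h : Matrix (Fin d) (Fin d) S) = y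
  iseqv :=
    { refl := fun x => ⟨1, H.one_mem, by simp⟩
      symm := by
        rintro x y ⟨h, hh, rfl⟩
        exact ⟨h⁻¹, H.inv_mem hh, by rw [Matrix.vecMul_vecMul, Units.mul_inv, Matrix.vecMul_one]⟩
      trans := by
        rintro x y z ⟨g, hg, rfl⟩ ⟨h, hh, rfl⟩
        exact ⟨g * h, H.mul_mem hg hh, by rw [Matrix.vecMul_vecMul, Units.val_mul]⟩ }

/-- The orbit-counting zeta function `∑ |(R/𝔓ⁿ)^d / G| Tⁿ`; the orbits of `G` on `(R/𝔓ⁿ)^d`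
are those of `Gₙ`. -/
def orbitZeta {d : ℕ} (G : Subgroup (GL (Fin d) R)) : PowerSeries ℚ :=
  PowerSeries.mk fun n => (Nat.card (Quotient (orbitSetoid (congruenceImage G n))) : ℚ)

/-- The conjugacy class zeta function `∑ k(Gₙ) Tⁿ`, where `k` denotes the number of conjugacy
classes. -/
def conjZeta {d : ℕ} (G : Subgroup (GL (Fin d) R)) : PowerSeries ℚ :=
  PowerSeries.mk fun n => (Nat.card (ConjClasses (congruenceImage G n)) : ℚ)

end Local

/-! ### Lie algebras -/

/-- The Lie algebra `𝔫_d(R)` of strictly upper triangular matrices. -/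
def strictUpper (R : Type*) [CommRing R] (d : ℕ) : LieSubalgebra R (Matrix (Fin d) (Fin d) R) where
  carrier := {a | ∀ i j, j ≤ i → a i j = 0}
  add_mem' := by
    intro a b ha hb i j hij
    simp [ha i j hij, hb i j hij]
  zero_mem' := by
    intro i j _
    rfl
  smul_mem' := by
    intro c a ha i j hij
    simp [ha i j hij]
  lie_mem' := by
    have key : ∀ a b : Matrix (Fin d) (Fin d) R, (∀ i j, j ≤ i → a i j = 0) →
        (∀ i j, j ≤ i → b i j = 0) → ∀ i j, j ≤ i → (a * b) i j = 0 := by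
      intro a b ha hb i j hij
      rw [Matrix.mul_apply]
      refine Finset.sum_eq_zero fun k _ => ?_
      rcases le_total k i with h | h
      · rw [ha i k h, zero_mul]
      · rw [hb k j (hij.trans h), mul_zero]
    intro a b ha hb i j hij
    rw [Ring.lie_def, Matrix.sub_apply, key a b ha hb i j hij, key b a hb ha i j hij, sub_zero]

/-- `𝔤 ⊆ 𝔫_d(R)` is isolated: `𝔫_d(R) / 𝔤` is a torsion-free `R`-module. -/
def IsIsolated {R : Type*} [CommRing R] {d : ℕ}
    (g : LieSubalgebra R (Matrix (Fin d) (Fin d) R)) : Prop :=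
  Module.IsTorsionFree R
    (strictUpper R d ⧸ g.toSubmodule.comap (strictUpper R d).toSubmodule.subtype)

/-- The module `ad(L) ⊆ Hom(L, L)` of the maps `ad(a) : b ↦ ⁅b, a⁆` for `a ∈ L`. -/
def adModule (R L : Type*) [CommRing R] [LieRing L] [LieAlgebra R L] :
    Submodule R (L →ₗ[R] L) :=
  LinearMap.range
    ((LieAlgebra.ad R L : L →ₗ[R] L →ₗ[R] L).flip)

end AskZeta

end

/-! The truncated series of exp and log are inverse to each other modulo `X ^ d` as soon as `1, …, d
- 1` are invertible, which `p ≥ d` guarantees in `𝔒`. Strictly upper triangular matrices have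
vanishing `d`-th power, so exp and log are inverse bijections between them and the unitriangular
matrices over `𝔒`, over `K` and over every `𝔒ₙ`, compatibly with reduction. In particular exp
identifies `𝔤ₙ` with `Gₙ` (`exists_texp_equiv`).

As `exp a - 1` is a polynomial multiple of `a` and conversely, `x exp(a) = x` iff `x a = 0`;
likewise `exp a` and `exp b` commute iff `a` and `b` do. The orbit-counting lemma and the count of
commuting pairs therefore turn orbits and conjugacy classes into average kernel sizes (`ask_range`).
For `ad` the domain is `𝔤 ⊗ 𝔒ₙ`, and isolation is what identifies it with `𝔤ₙ`
(`ker_toReducedMatrices`).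

That `exp(𝔤)` is closed under products is a qualitative Campbell–Hausdorff theorem. The path `z =
log(exp(a) exp(Xb))` satisfies `(exp z)' = exp(z) b`; solving for `z'` expresses it by iterated
brackets of `b` with `z`, so all coefficients of `z` lie in the Lie algebra, by induction on degree
(`coeff_mem_of_derivative_exp`). This is done over `ℚ`; isolation brings the result back to `𝔤`. -/

open AskZeta
open Polynomial
open scoped Nat

/-! ### The valuation ring: discrete, with finite quotients, and with `1, …, p - 1` invertible. -/

namespace AskZeta
section ValuationRing

variable (p : ℕ) [Fact p.Prime] (K : Type*) [Field K] [Algebra ℚ_[p] K]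
  [FiniteDimensional ℚ_[p] K]

/-- A finite-dimensional normed space over `ℚ_[p]` is proper, so the closed unit ball is compact,
and a compact valuation ring is discrete with finite residue field. -/
theorem isDiscreteValuationRing_and_finite_residueField :
    IsDiscreteValuationRing (valuationRing p K) ∧
      Finite (IsLocalRing.ResidueField (valuationRing p K)) := by
  let : NontriviallyNormedField K := spectralNorm.nontriviallyNormedField ℚ_[p] K
  let : NormedSpace ℚ_[p] K := spectralNorm.normedSpace ℚ_[p] K
  have : IsUltrametricDist K := IsUltrametricDist.isUltrametricDist_of_isNonarchimedean_norm
    (isNonarchimedean_spectralNorm (K := ℚ_[p]) (L := K))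
  have : ProperSpace K := FiniteDimensional.proper ℚ_[p] K
  let := NormedField.toValued (K := K)
  let e : valuationRing p K ≃+* Valued.integer K :=
    RingEquiv.subringCongr (s := (valuationRing p K).toSubring) (by
      ext x
      exact (Valued.integer.mem_iff (K := K) (x := x)).symm)
  have hc : CompactSpace (Valued.integer K) := by
    refine isCompact_iff_compactSpace (s := (Valued.integer K : Set K)).1 ?_
    convert! isCompact_closedBall (0 : K) 1
    ext x
    rw [mem_closedBall_zero_iff]
    exact Valued.integer.mem_iff (K := K) (x := x)
  have : (Valued.v : Valuation K NNReal).RankOne :=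
    inferInstanceAs (Valuation.RankOne (NormedField.valuation (K := K)))
  have hd : IsDiscreteValuationRing (Valued.integer K) :=
    Valued.integer.isDiscreteValuationRing_of_compactSpace
  have hf := IsLocalRing.finite_residueField_of_compactSpace (R := Valued.integer K)
  exact ⟨IsDiscreteValuationRing.RingEquivClass.isDiscreteValuationRing e.symm,
    .of_equiv _ (IsLocalRing.ResidueField.mapEquiv e.symm).toEquiv⟩

theorem finite_quot (n : ℕ) : Finite (Quot (valuationRing p K) n) := by
  have ⟨_, _⟩ := isDiscreteValuationRing_and_finite_residueField p K
  have : Finite (valuationRing p K ⧸ IsLocalRing.maximalIdeal (valuationRing p K)) :=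
    ‹Finite (IsLocalRing.ResidueField (valuationRing p K))›
  exact Ideal.finite_quotient_pow (IsNoetherian.noetherian _) _

theorem exists_maximalIdeal_pow_eq_span (n : ℕ) : ∃ r : valuationRing p K, r ≠ 0 ∧
    IsLocalRing.maximalIdeal (valuationRing p K) ^ n = Ideal.span {r} := by
  have ⟨_, _⟩ := isDiscreteValuationRing_and_finite_residueField p K
  obtain ⟨x, hx⟩ := IsDiscreteValuationRing.exists_irreducible (valuationRing p K)
  exact ⟨x ^ n, pow_ne_zero _ hx.ne_zero, by rw [hx.maximalIdeal_eq, Ideal.span_singleton_pow]⟩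

theorem isUnit_natCast_of_lt {i : ℕ} (h0 : 0 < i) (hi : i < p) :
    IsUnit (i : valuationRing p K) := by
  have h1 : spectralNorm ℚ_[p] K (i : K) = 1 := by
    rw [← map_natCast (algebraMap ℚ_[p] K), spectralNorm_extends, Padic.norm_natCast_eq_one_iff]
    exact ((Nat.Prime.coprime_iff_not_dvd Fact.out).2 (Nat.not_dvd_of_pos_of_lt h0 hi))
  have h0 : (i : K) ≠ 0 := by
    rintro h
    rw [h, spectralNorm_zero] at h1
    exact zero_ne_one h1
  have h2 : spectralNorm ℚ_[p] K ((i : K)⁻¹) = 1 := by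
    have h : spectralNorm ℚ_[p] K (i : K)⁻¹ = _ := map_inv₀ (spectralMulAlgNorm ℚ_[p] K) (i : K)
    rw [h, spectralMulAlgNorm_def, h1, inv_one]
  refine IsUnit.of_mul_eq_one ⟨(i : K)⁻¹, h2.le⟩ (Subtype.ext ?_)
  exact mul_inv_cancel₀ h0

end ValuationRing
end AskZeta

/-! ### Truncated exponential and logarithm as polynomials. -/

namespace AskZeta
section TruncatedExp

variable (R : Type*) [CommRing R] (d : ℕ)

/-- The truncated exponential series `∑_{i < d} Xⁱ / i!`. -/
noncomputable def expPoly : R[X] := ∑ i ∈ Finset.range d, C (Ring.inverse (i ! : R)) * X ^ i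

/-- The truncation of the series `log (1 + X)` in degrees `< d`. -/
noncomputable def logPoly : R[X] :=
  ∑ i ∈ Finset.range d, C ((-1) ^ (i + 1) * Ring.inverse (i : R)) * X ^ i

/-- The integers `1, …, d - 1` are invertible in `R`. -/
def UnitsBelow : Prop := ∀ i : ℕ, 0 < i → i < d → IsUnit (i : R)

variable {R d}

theorem UnitsBelow.factorial (h : UnitsBelow R d) {i : ℕ} (hi : i < d) : IsUnit (i ! : R) := by
  induction i with
  | zero => simp
  | succ i ih =>
    rw [Nat.factorial_succ, Nat.cast_mul]
    exact (h _ i.succ_pos hi).mul (ih (Nat.lt_of_succ_lt hi))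

theorem unitsBelow_rat : UnitsBelow ℚ d := fun i h0 _ => by
  simpa using h0.ne'

theorem expPoly_coeff_zero (hd : 0 < d) : (expPoly R d).coeff 0 = 1 := by
  rw [expPoly, finsetSum_coeff, Finset.sum_eq_single 0]
  · simp
  · intro i _ hi
    simp [coeff_X_pow, hi.symm]
  · intro h
    exact absurd (Finset.mem_range.2 hd) h

theorem logPoly_coeff_zero : (logPoly R d).coeff 0 = 0 := by
  rw [logPoly, finsetSum_coeff]
  refine Finset.sum_eq_zero fun i _ => ?_
  rcases eq_or_ne i 0 with rfl | hi
  -- The term `i = 0` vanishes because `Ring.inverse 0 = 0` in a nontrivial ring.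
  · rcases subsingleton_or_nontrivial R with _ | _
    · exact Subsingleton.elim _ _
    · simp
  · simp [coeff_X_pow, hi.symm]

theorem derivative_expPoly {m : ℕ} (h : UnitsBelow R (m + 1)) :
    derivative (expPoly R (m + 1)) = expPoly R m := by
  rw [expPoly, Finset.sum_range_succ', derivative_add, derivative_sum, expPoly]
  simp only [pow_zero, mul_one, derivative_C, add_zero]
  refine Finset.sum_congr rfl fun i hi => ?_
  have hi := Finset.mem_range.1 hi
  have h1 := h.factorial (i := i + 1) (by omega)
  have h2 := h.factorial (i := i) (by omega)
  rw [derivative_C_mul, derivative_X_pow, ← mul_assoc, ← C_mul, Nat.add_sub_cancel]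
  congr 2
  apply h1.mul_left_cancel
  rw [← mul_assoc, Ring.mul_inverse_cancel _ h1, Nat.factorial_succ, Nat.cast_mul, mul_assoc,
    Ring.mul_inverse_cancel _ h2, one_mul, mul_one]

theorem one_add_X_mul_derivative_logPoly {m : ℕ} (h : UnitsBelow R (m + 1)) :
    (1 + X) * derivative (logPoly R (m + 1)) = 1 - (-X) ^ m := by
  have : derivative (logPoly R (m + 1)) = ∑ i ∈ Finset.range m, (-X) ^ i := by
    rw [logPoly, Finset.sum_range_succ', derivative_add, derivative_sum]
    simp only [pow_zero, mul_one, derivative_C, add_zero]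
    refine Finset.sum_congr rfl fun i hi => ?_
    have h1 := h (i + 1) i.succ_pos (by have := Finset.mem_range.1 hi; omega)
    rw [derivative_C_mul, derivative_X_pow, ← mul_assoc, ← C_mul, Nat.add_sub_cancel,
      mul_assoc, Ring.inverse_mul_cancel _ h1, neg_pow (X : R[X])]
    congr 1
    simp [pow_succ]
  rw [this]
  simpa using mul_neg_geom_sum (-X : R[X]) m

theorem X_pow_succ_dvd_of_derivative {m : ℕ} (h : UnitsBelow R (m + 1)) {F : R[X]}
    (h0 : F.coeff 0 = 0) (h1 : X ^ m ∣ derivative F) : X ^ (m + 1) ∣ F := by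
  rw [X_pow_dvd_iff] at h1 ⊢
  rintro (_ | i) hi
  · exact h0
  · have := h1 i (by omega)
    rw [coeff_derivative] at this
    have hu := h (i + 1) i.succ_pos hi
    push_cast at hu
    exact hu.mul_left_eq_zero.1 this

theorem X_dvd_expPoly_sub_one (hd : 0 < d) : X ∣ expPoly R d - 1 := by
  rw [X_dvd_iff, coeff_sub, expPoly_coeff_zero hd, coeff_one_zero, sub_self]

theorem X_dvd_logPoly : X ∣ logPoly R d := X_dvd_iff.2 logPoly_coeff_zero

theorem expPoly_succ (m : ℕ) :
    expPoly R m = expPoly R (m + 1) - C (Ring.inverse (m ! : R)) * X ^ m := by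
  rw [expPoly, expPoly, Finset.sum_range_succ, add_sub_cancel_right]

/-- The constant term vanishes, so it suffices that the derivative is divisible by `X ^ (d - 1)`:
formally it is `exp' / exp - 1 = 0`, and truncation only leaves terms of that order. -/
theorem X_pow_dvd_logPoly_comp (h : UnitsBelow R d) :
    X ^ d ∣ (logPoly R d).comp (expPoly R d - 1) - X := by
  rcases d with _ | m
  · simp
  obtain ⟨q, hq⟩ := X_dvd_expPoly_sub_one (R := R) m.succ_pos
  apply X_pow_succ_dvd_of_derivative h
  · obtain ⟨l, hl⟩ := X_dvd_logPoly (R := R) (d := m + 1)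
    rw [← X_dvd_iff, hl, mul_comp, X_comp, hq]
    exact dvd_sub (dvd_mul_of_dvd_left (dvd_mul_right _ _) _) dvd_rfl
  · have h1 := congrArg (fun f => f.comp (expPoly R (m + 1) - 1))
      (one_add_X_mul_derivative_logPoly h)
    simp only [mul_comp, add_comp, one_comp, X_comp, sub_comp, pow_comp, neg_comp] at h1
    rw [derivative_sub, derivative_X, derivative_comp, derivative_sub, derivative_one, sub_zero,
      derivative_expPoly h, expPoly_succ m]
    set Q := (derivative (logPoly R (m + 1))).comp (expPoly R (m + 1) - 1)
    refine ⟨-((-q) ^ m) - C (Ring.inverse (m ! : R)) * Q, ?_⟩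
    rw [hq] at h1
    have h2 : expPoly R (m + 1) = 1 + X * q := by rw [← hq]; ring
    rw [h2]
    have h3 : (-(X * q)) ^ m = X ^ m * (-q) ^ m := by rw [← mul_pow]; ring
    linear_combination h1 - h3

/-- The difference `F` satisfies `(1 + X) F' ≡ F` modulo `X ^ (d - 1)` and has no constant term,
which forces it to vanish to order `d`. -/
theorem X_pow_dvd_expPoly_comp (h : UnitsBelow R d) :
    X ^ d ∣ (expPoly R d).comp (logPoly R d) - 1 - X := by
  rcases d with _ | m
  · simp
  obtain ⟨q, hq⟩ := X_dvd_expPoly_sub_one (R := R) m.succ_pos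
  obtain ⟨l, hl⟩ := X_dvd_logPoly (R := R) (d := m + 1)
  set F := (expPoly R (m + 1)).comp (logPoly R (m + 1)) - 1 - X with hF
  have h0 : X ∣ F := by
    have : expPoly R (m + 1) = 1 + X * q := by rw [← hq]; ring
    rw [hF, this, add_comp, one_comp, mul_comp, X_comp, hl]
    exact dvd_sub ⟨l * q.comp (X * l), by ring⟩ dvd_rfl
  have h1 : X ^ m ∣ (1 + X) * derivative F - F := by
    have h2 := one_add_X_mul_derivative_logPoly h
    have h3 : derivative F = derivative (logPoly R (m + 1)) *
        ((expPoly R (m + 1)).comp (logPoly R (m + 1)) -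
          C (Ring.inverse (m ! : R)) * logPoly R (m + 1) ^ m) - 1 := by
      rw [hF, derivative_sub, derivative_X, derivative_sub, derivative_one, sub_zero,
        derivative_comp, derivative_expPoly h, expPoly_succ m]
      simp
    set c := C (Ring.inverse (m ! : R))
    set D := derivative (logPoly R (m + 1))
    set E := (expPoly R (m + 1)).comp (logPoly R (m + 1))
    refine ⟨-((-1) ^ m * E) - c * l ^ m * (1 - (-X) ^ m), ?_⟩
    have h4 : (-X : R[X]) ^ m = (X : R[X]) ^ m * (-1) ^ m := by rw [← mul_pow]; ring
    rw [h3, hF]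
    have h5 : logPoly R (m + 1) ^ m = X ^ m * l ^ m := by rw [hl, mul_pow]
    rw [h5]
    linear_combination (E - c * (X ^ m * l ^ m)) * h2 - E * h4
  -- Each pass gains one order: `X ^ (k + 1)` divides `F`, hence `(1 + X) F'`, hence `F'` since `1 +
  -- X` is coprime to `X`; integrating gives `X ^ (k + 2) ∣ F`.
  have key : ∀ k ≤ m, X ^ (k + 1) ∣ F := by
    intro k
    induction k with
    | zero => simpa using h0
    | succ k ih =>
      intro hk
      have hF := ih (by omega)
      apply X_pow_succ_dvd_of_derivative (fun i h0 hi => h i h0 (by omega)) (X_dvd_iff.1 h0)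
      have hc : IsCoprime (X ^ (k + 1) : R[X]) (1 + X) :=
        IsCoprime.pow_left ⟨-1, 1, by ring⟩
      refine hc.dvd_of_dvd_mul_left ?_
      have := dvd_add ((pow_dvd_pow X hk).trans h1) hF
      simpa using this
  exact key m le_rfl

variable {A B : Type*} [Ring A] [Algebra R A] [Ring B] [Algebra R B]

variable (R d) in
/-- The truncated exponential. -/
noncomputable def texp (a : A) : A := aeval a (expPoly R d)

variable (R d) in
/-- The truncated logarithm. -/
noncomputable def tlog (u : A) : A := aeval (u - 1) (logPoly R d)

theorem aeval_eq_of_X_pow_dvd {P Q : R[X]} (h : X ^ d ∣ P - Q) {a : A} (ha : a ^ d = 0) :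
    aeval a P = aeval a Q := by
  obtain ⟨q, hq⟩ := h
  rw [← sub_eq_zero, ← map_sub, hq, map_mul, map_pow, aeval_X, ha, zero_mul]

theorem tlog_texp (h : UnitsBelow R d) {a : A} (ha : a ^ d = 0) : tlog R d (texp R d a) = a := by
  have := aeval_eq_of_X_pow_dvd (X_pow_dvd_logPoly_comp h) ha
  rwa [aeval_comp, map_sub, map_one, aeval_X] at this

theorem texp_tlog (h : UnitsBelow R d) {u : A} (hu : (u - 1) ^ d = 0) :
    texp R d (tlog R d u) = u := by
  have := X_pow_dvd_expPoly_comp h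
  rw [sub_sub] at this
  have := aeval_eq_of_X_pow_dvd this hu
  rwa [aeval_comp, map_add, map_one, aeval_X, add_sub_cancel] at this

theorem map_texp (f : A →ₐ[R] B) (a : A) : f (texp R d a) = texp R d (f a) :=
  (aeval_algHom_apply f a _).symm

theorem map_tlog (f : A →ₐ[R] B) (a : A) : f (tlog R d a) = tlog R d (f a) := by
  rw [tlog, ← aeval_algHom_apply, map_sub, map_one, tlog]

theorem texp_eq_sum (a : A) :
    texp R d a = ∑ i ∈ Finset.range d, Ring.inverse (i ! : R) • a ^ i := by
  simp [texp, expPoly, map_sum, Algebra.smul_def]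

theorem texp_eq_exp [Module ℚ A] (h : UnitsBelow R d) {a : A} (ha : a ^ d = 0) :
    texp R d a = IsNilpotent.exp a := by
  rw [texp_eq_sum, IsNilpotent.exp_eq_sum ha]
  refine Finset.sum_congr rfl fun i hi => ?_
  have h1 := h.factorial (Finset.mem_range.1 hi)
  have h2 : ((i ! : ℕ) : ℚ) ≠ 0 := by exact_mod_cast i.factorial_ne_zero
  have h3 : (i ! : ℕ) • (Ring.inverse (i ! : R) • a ^ i) = a ^ i := by
    rw [← Nat.cast_smul_eq_nsmul R, smul_smul, Ring.mul_inverse_cancel _ h1, one_smul]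
  rw [← Nat.cast_smul_eq_nsmul ℚ] at h3
  exact (eq_inv_smul_iff₀ h2).2 h3

theorem pow_eq_zero_of_X_dvd {P : R[X]} (hP : X ∣ P) {a : A} (ha : a ^ d = 0) :
    aeval a P ^ d = 0 := by
  obtain ⟨q, rfl⟩ := hP
  rw [← map_pow, mul_pow, map_mul, map_pow, aeval_X, ha, zero_mul]

end TruncatedExp
end AskZeta

/-! ### The derivative of the exponential. -/

namespace AskZeta
section DerivativeOfExp

theorem isNilpotent_mulLeft_sub_mulRight {C : Type*} [Ring C] [Algebra ℚ C] {l : C}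
    (hl : IsNilpotent l) :
    IsNilpotent (LinearMap.mulLeft ℚ l - LinearMap.mulRight ℚ l : Module.End ℚ C) :=
  (LinearMap.commute_mulLeft_right (R := ℚ) l l).isNilpotent_sub
    ((LinearMap.isNilpotent_mulLeft_iff ℚ l).2 hl) ((LinearMap.isNilpotent_mulRight_iff ℚ l).2 hl)

/-- Left and right multiplication commute, so the exponential of their difference factors: `Ad (exp
l) = exp (ad l)`. -/
theorem exp_mul_mul_exp_neg {C : Type*} [Ring C] [Algebra ℚ C] {l : C} (hl : IsNilpotent l)
    (x : C) : IsNilpotent.exp l * x * IsNilpotent.exp (-l) =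
      IsNilpotent.exp (LinearMap.mulLeft ℚ l - LinearMap.mulRight ℚ l : Module.End ℚ C) x := by
  have h1 : IsNilpotent (LinearMap.mulLeft ℚ l) := (LinearMap.isNilpotent_mulLeft_iff ℚ l).2 hl
  have h2 : IsNilpotent (LinearMap.mulRight ℚ l) := (LinearMap.isNilpotent_mulRight_iff ℚ l).2 hl
  rw [sub_eq_add_neg, IsNilpotent.exp_add_of_commute
    ((LinearMap.commute_mulLeft_right (R := ℚ) l l).neg_right) h1 h2.neg]
  obtain ⟨N, hN⟩ := hl
  have h3 : (-l) ^ N = 0 := by rw [neg_pow, hN, mul_zero]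
  have h4 : LinearMap.mulLeft ℚ l ^ N = 0 := by
    rw [LinearMap.pow_mulLeft, hN, LinearMap.mulLeft_zero_eq_zero]
  have h5 : -LinearMap.mulRight ℚ l = LinearMap.mulRight ℚ (-l) := by
    ext y; simp
  have h6 : LinearMap.mulRight ℚ (-l) ^ N = 0 := by
    rw [LinearMap.pow_mulRight, h3, LinearMap.mulRight_zero_eq_zero]
  rw [h5, IsNilpotent.exp_eq_sum h4, IsNilpotent.exp_eq_sum h6, IsNilpotent.exp_eq_sum hN,
    IsNilpotent.exp_eq_sum h3]
  simp [LinearMap.pow_mulLeft, LinearMap.pow_mulRight, Finset.mul_sum, Finset.sum_mul, mul_assoc]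

/-- The derivative of the exponential of a nilpotent element, for a derivation `D`. -/
theorem exists_exp_neg_mul_derivation_exp {B : Type*} [Ring B] [Algebra ℚ B] (D : B →ₗ[ℚ] B)
    (hD : ∀ x y, D (x * y) = D x * y + x * D y) {z : B} (hz : IsNilpotent z) :
    ∃ M : ℕ, 0 < M ∧ (LinearMap.mulRight ℚ z - LinearMap.mulLeft ℚ z) ^ M = 0 ∧
      IsNilpotent.exp (-z) * D (IsNilpotent.exp z) = ∑ k ∈ Finset.range M,
        (((k + 1)! : ℕ) : ℚ)⁻¹ • ((LinearMap.mulRight ℚ z - LinearMap.mulLeft ℚ z) ^ k) (D z) := by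
  set T : Module.End ℚ B := LinearMap.mulRight ℚ z - LinearMap.mulLeft ℚ z with hT
  have hTn : IsNilpotent T := by
    rw [hT, ← neg_sub]
    exact (isNilpotent_mulLeft_sub_mulRight hz).neg
  set l : Module.End ℚ B := LinearMap.mulLeft ℚ z with hl
  have hln : IsNilpotent l := (LinearMap.isNilpotent_mulLeft_iff ℚ z).2 hz
  -- Conjugate the operator `D` itself by `exp l` inside `End B`. The commutator `U D` is left
  -- multiplication by `D z`, and from there `U` acts through `T`; evaluating at `1` gives the
  -- formula.
  set U : Module.End ℚ (Module.End ℚ B) := LinearMap.mulLeft ℚ (-l) - LinearMap.mulRight ℚ (-l)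
    with hU
  have hUn : IsNilpotent U := isNilpotent_mulLeft_sub_mulRight hln.neg
  obtain ⟨M₁, h₁⟩ := hTn
  obtain ⟨M₂, h₂⟩ := hUn
  obtain ⟨N, hN⟩ := id hz
  have hexp : ∀ y : B, y ^ N = 0 →
      IsNilpotent.exp (LinearMap.mulLeft ℚ y) = LinearMap.mulLeft ℚ (IsNilpotent.exp y) := by
    intro y hy
    have : LinearMap.mulLeft ℚ y ^ N = 0 := by
      rw [LinearMap.pow_mulLeft, hy, LinearMap.mulLeft_zero_eq_zero]
    rw [IsNilpotent.exp_eq_sum this, IsNilpotent.exp_eq_sum hy]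
    ext x
    simp [LinearMap.pow_mulLeft, Finset.sum_mul]
  have hD1 : D 1 = 0 := by simpa using hD 1 1
  have hU0 : U D = LinearMap.mulLeft ℚ (D z) := by
    ext x
    simp [hU, hl, hD]
  have hU1 : ∀ w, U (LinearMap.mulLeft ℚ w) = LinearMap.mulLeft ℚ (T w) := by
    intro w
    ext x
    simp [hU, hl, hT, sub_mul, mul_assoc]
    abel
  have hUk : ∀ k, (U ^ (k + 1)) D = LinearMap.mulLeft ℚ ((T ^ k) (D z)) := by
    intro k
    induction k with
    | zero => simpa using hU0
    | succ k ih => rw [pow_succ', Module.End.mul_apply, ih, hU1, pow_succ' T, Module.End.mul_apply]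
  -- One bound serves both series. The series in `U` has one more term, its zeroth, which
  -- contributes `D 1 = 0`.
  refine ⟨M₁ + M₂ + 1, by omega, pow_eq_zero_of_le (by omega) h₁, ?_⟩
  have key := congrArg (fun f : Module.End ℚ B => f 1) (exp_mul_mul_exp_neg hln.neg D)
  have hneg : -l = LinearMap.mulLeft ℚ (-z) := by ext; simp [hl]
  simp only [neg_neg] at key
  rw [← hU, IsNilpotent.exp_eq_sum (a := U) (pow_eq_zero_of_le (n := M₁ + M₂ + 1 + 1) (by omega) h₂),
    hneg, hexp _ (by rw [neg_pow, hN, mul_zero]), hl, hexp _ hN, Finset.sum_range_succ'] at key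
  simpa [hUk, hD1] using key

end DerivativeOfExp

/-! ### The differential equation behind Campbell–Hausdorff. -/

section CampbellHausdorff

variable {A : Type*} [Ring A] [Algebra ℚ A]

theorem exp_C_mul_derivative {y : A[X]} {b : A} (hy : IsNilpotent y)
    (hd : derivative y = C b) (hc : Commute y (C b)) :
    derivative (IsNilpotent.exp y) = IsNilpotent.exp y * C b := by
  obtain ⟨M, hM, -, h⟩ := exists_exp_neg_mul_derivation_exp
    (derivative.restrictScalars ℚ : A[X] →ₗ[ℚ] A[X]) (fun x y => derivative_mul) hy
  obtain ⟨M, rfl⟩ := Nat.exists_eq_add_of_lt hM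
  rw [Finset.sum_range_succ'] at h
  simp only [LinearMap.restrictScalars_apply, hd] at h
  rw [Finset.sum_eq_zero] at h
  · have := congrArg (IsNilpotent.exp y * ·) h
    simpa [← mul_assoc, IsNilpotent.exp_mul_exp_neg_self hy] using this
  · intro k _
    rw [pow_succ, Module.End.mul_apply]
    simp [hc.eq]

/-- If `exp z` satisfies the differential equation `(exp z)' = exp z * b` and `z(0)` and `b` lie in
a Lie subalgebra, then so do all coefficients of `z`. -/
theorem coeff_mem_of_derivative_exp (h : Submodule ℚ A)
    (hlie : ∀ x ∈ h, ∀ y ∈ h, x * y - y * x ∈ h) {z : A[X]} (hz : IsNilpotent z) {b : A}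
    (hb : b ∈ h) (h0 : z.coeff 0 ∈ h)
    (hd : derivative (IsNilpotent.exp z) = IsNilpotent.exp z * C b) (n : ℕ) : z.coeff n ∈ h := by
  obtain ⟨M, hM, hT, key⟩ := exists_exp_neg_mul_derivation_exp
    (derivative.restrictScalars ℚ : A[X] →ₗ[ℚ] A[X]) (fun x y => derivative_mul) hz
  simp only [LinearMap.restrictScalars_apply, hd] at key
  rw [← mul_assoc, IsNilpotent.exp_neg_mul_exp_self hz, one_mul] at key
  set T : Module.End ℚ A[X] := LinearMap.mulRight ℚ z - LinearMap.mulLeft ℚ z with hTdef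
  -- A truncation of `(exp X - 1) / X`. Its constant term is `1`, so it is invertible modulo `X ^
  -- M`, and `P(T) z' = b` can be solved as `z' = v(T) b`.
  let P : ℚ[X] := ∑ k ∈ Finset.range M, C (((k + 1)! : ℕ) : ℚ)⁻¹ * X ^ k
  have hP : aeval T P (derivative z) = C b := by
    rw [key]
    simp [P, map_sum, LinearMap.sum_apply, Algebra.algebraMap_eq_smul_one]
  have hP0 : P.coeff 0 = 1 := by
    simp only [P, finsetSum_coeff]
    rw [Finset.sum_eq_single 0]
    · simp
    · intro i _ hi
      simp [coeff_X_pow, hi.symm]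
    · intro hh
      exact absurd (Finset.mem_range.2 hM) hh
  have hcop : IsCoprime (X ^ M : ℚ[X]) P := by
    apply IsCoprime.pow_left
    rw [irreducible_X.coprime_iff_not_dvd, X_dvd_iff, hP0]
    exact one_ne_zero
  obtain ⟨u, v, huv⟩ := hcop
  have hw : aeval T v (C b) = derivative z := by
    rw [← hP, ← Module.End.mul_apply, ← map_mul, ← sub_eq_of_eq_add' huv.symm, map_sub, map_mul,
      map_pow, aeval_X, hT, mul_zero, sub_zero, map_one, Module.End.one_apply]
  suffices H : ∀ n, ∀ k ≤ n, z.coeff k ∈ h from H n n le_rfl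
  intro n
  induction n with
  | zero =>
    intro k hk
    rwa [Nat.le_zero.1 hk]
  | succ n ih =>
    intro k hk
    rcases hk.lt_or_eq with hk | rfl
    · exact ih k (by omega)
    -- Only coefficients up to degree `n` matter: this space is stable under `T`, since that part of
    -- `T f` uses only brackets with `z₀, …, zₙ`. So `z'` lies in it, and its `n`-th coefficient is
    -- `(n + 1) zₙ₊₁`.
    let S : Submodule ℚ A[X] :=
      { carrier := {f | ∀ k ≤ n, f.coeff k ∈ h}
        add_mem' := fun hf hg k hk => by rw [coeff_add]; exact h.add_mem (hf k hk) (hg k hk)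
        zero_mem' := fun k _ => by simp
        smul_mem' := fun c f hf k hk => by rw [coeff_smul]; exact h.smul_mem c (hf k hk) }
    have hTS : S ≤ S.comap T := by
      intro f hf k hk
      have : (T f).coeff k = ∑ x ∈ Finset.HasAntidiagonal.antidiagonal k,
          (f.coeff x.1 * z.coeff x.2 - z.coeff x.2 * f.coeff x.1) := by
        rw [Finset.sum_sub_distrib, ← Finset.Nat.sum_antidiagonal_swap
          (f := fun x => z.coeff x.2 * f.coeff x.1)]
        simp [hTdef, coeff_mul]
      rw [this]
      refine h.sum_mem fun x hx => ?_
      have := Finset.HasAntidiagonal.mem_antidiagonal.1 hx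
      exact hlie _ (hf _ (by omega)) _ (ih _ (by omega))
    have hbS : C b ∈ S := by
      intro k _
      rw [coeff_C]
      split_ifs
      · exact hb
      · exact h.zero_mem
    have hmem : derivative z ∈ S := by
      rw [← hw]
      exact aeval_apply_smul_mem_of_le_comap' hbS v T hTS
    have := hmem n le_rfl
    rw [coeff_derivative] at this
    have h2 := h.smul_mem ((n + 1 : ℚ)⁻¹) this
    have h3 : z.coeff (n + 1) * ((n : A) + 1) = (n + 1 : ℚ) • z.coeff (n + 1) := by
      rw [mul_add_one, add_smul, one_smul, ← Nat.cast_comm, ← nsmul_eq_mul,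
        Nat.cast_smul_eq_nsmul]
    rwa [h3, smul_smul, inv_mul_cancel₀ (by positivity), one_smul] at h2

end CampbellHausdorff
end AskZeta

/-! ### Strictly upper triangular matrices and closure under multiplication over `ℚ`. -/

namespace AskZeta
section StrictUpper

variable {R S : Type*} [CommRing R] [CommRing S] [Algebra R S] {d : ℕ}

theorem mul_mem_strictUpper {a b : Matrix (Fin d) (Fin d) S} (ha : a ∈ strictUpper S d)
    (hb : b ∈ strictUpper S d) : a * b ∈ strictUpper S d := by
  intro i j hij
  rw [Matrix.mul_apply]
  refine Finset.sum_eq_zero fun k _ => ?_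
  rcases le_total k i with h | h
  · rw [ha i k h, zero_mul]
  · rw [hb k j (hij.trans h), mul_zero]

theorem pow_eq_zero_of_mem_strictUpper {a : Matrix (Fin d) (Fin d) S} (ha : a ∈ strictUpper S d) :
    a ^ d = 0 := by
  have h : a.charpoly = X ^ d := by
    rw [Matrix.charpoly_of_isUpperTriangular a fun i j hij => ha i j (le_of_lt hij)]
    simp [ha _ _ le_rfl]
  simpa [h] using Matrix.aeval_self_charpoly a

theorem aeval_mem_strictUpper {P : R[X]} (hP : X ∣ P) {a : Matrix (Fin d) (Fin d) S}
    (ha : a ∈ strictUpper S d) : aeval a P ∈ strictUpper S d := by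
  have hpow : ∀ n : ℕ, a ^ (n + 1) ∈ strictUpper S d := by
    intro n
    induction n with
    | zero => simpa using ha
    | succ n ih => rw [pow_succ]; exact mul_mem_strictUpper ih ha
  obtain ⟨q, rfl⟩ := hP
  induction q using Polynomial.induction_on' with
  | add p q hp hq => rw [mul_add, map_add]; exact add_mem hp hq
  | monomial n c =>
    rw [X_mul_monomial, aeval_monomial, ← Algebra.smul_def]
    intro i j hij
    rw [Matrix.smul_apply, hpow n i j hij, smul_zero]

theorem texp_sub_one_mem_strictUpper {a : Matrix (Fin d) (Fin d) S}
    (ha : a ∈ strictUpper S d) : texp R d a - 1 ∈ strictUpper S d := by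
  rcases Nat.eq_zero_or_pos d with rfl | hd
  · exact fun i => i.elim0
  · simpa [texp] using aeval_mem_strictUpper (X_dvd_expPoly_sub_one (R := R) hd) ha

theorem tlog_mem_strictUpper {u : Matrix (Fin d) (Fin d) S}
    (hu : u - 1 ∈ strictUpper S d) : tlog R d u ∈ strictUpper S d :=
  aeval_mem_strictUpper X_dvd_logPoly hu

theorem mul_sub_one_mem_strictUpper {u v : Matrix (Fin d) (Fin d) S}
    (hu : u - 1 ∈ strictUpper S d) (hv : v - 1 ∈ strictUpper S d) :
    u * v - 1 ∈ strictUpper S d := by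
  have : u * v - 1 = (u - 1) * (v - 1) + (u - 1) + (v - 1) := by noncomm_ring
  rw [this]
  exact add_mem (add_mem (mul_mem_strictUpper hu hv) hu) hv

theorem map_mem_strictUpper {T : Type*} [CommRing T] (f : S →+* T) {a : Matrix (Fin d) (Fin d) S}
    (ha : a ∈ strictUpper S d) : a.map f ∈ strictUpper T d := fun i j hij => by
  simp [ha i j hij]

theorem texp_zero : texp R d (0 : Matrix (Fin d) (Fin d) S) = 1 := by
  rw [texp_eq_sum]
  rcases d with _ | d
  · exact Subsingleton.elim _ _
  · simp [Finset.sum_range_succ']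

/-- The qualitative Campbell-Baker-Hausdorff theorem: the exponentials of a Lie algebra of strictly
upper triangular matrices in characteristic zero are closed under multiplication. -/
theorem exists_mem_texp_eq_mul [Algebra ℚ S] (h : Submodule ℚ (Matrix (Fin d) (Fin d) S))
    (hle : ∀ x ∈ h, x ∈ strictUpper S d) (hlie : ∀ x ∈ h, ∀ y ∈ h, x * y - y * x ∈ h)
    {a b : Matrix (Fin d) (Fin d) S} (ha : a ∈ h) (hb : b ∈ h) :
    ∃ c ∈ h, texp ℚ d c = texp ℚ d a * texp ℚ d b := by
  have hu := unitsBelow_rat (d := d)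
  -- Nilpotency in the polynomial ring over matrices is read off from triangular matrices with
  -- polynomial entries.
  let e : Matrix (Fin d) (Fin d) S[X] →ₐ[ℚ] (Matrix (Fin d) (Fin d) S)[X] :=
    (matPolyEquiv : _ ≃ₐ[S] _).toAlgHom.restrictScalars ℚ
  let y : (Matrix (Fin d) (Fin d) S)[X] := X * C b
  have hea : e (a.map C) = C a := matPolyEquiv_map_C a
  have hey : e ((X : S[X]) • b.map C) = y := by
    change matPolyEquiv _ = _
    rw [matPolyEquiv_map_smul, matPolyEquiv_map_C, Polynomial.map_X]
  have ha' := map_mem_strictUpper C (hle a ha)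
  have hb' : (X : S[X]) • b.map C ∈ strictUpper S[X] d :=
    (strictUpper S[X] d).smul_mem X (map_mem_strictUpper C (hle b hb))
  have hy : y ^ d = 0 := by rw [← hey, ← map_pow, pow_eq_zero_of_mem_strictUpper hb', map_zero]
  set u := texp ℚ d (C a) * texp ℚ d y with hudef
  have hu1 : (u - 1) ^ d = 0 := by
    rw [hudef, ← hea, ← hey, ← map_texp, ← map_texp, ← map_mul, ← map_one e, ← map_sub, ← map_pow,
      pow_eq_zero_of_mem_strictUpper (mul_sub_one_mem_strictUpper
        (texp_sub_one_mem_strictUpper ha') (texp_sub_one_mem_strictUpper hb')), map_zero]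
  set z := tlog ℚ d u with hzdef
  have hz : z ^ d = 0 := pow_eq_zero_of_X_dvd X_dvd_logPoly hu1
  have hzu : texp ℚ d z = u := texp_tlog hu hu1
  have hCa : texp ℚ d (C a) = C (texp ℚ d a) :=
    (map_texp (CAlgHom : _ →ₐ[ℚ] (Matrix (Fin d) (Fin d) S)[X]) a).symm
  have hd : derivative (IsNilpotent.exp z) = IsNilpotent.exp z * C b := by
    rw [← texp_eq_exp hu hz, hzu, hudef, hCa, derivative_mul, derivative_C, zero_mul, zero_add,
      texp_eq_exp hu hy, mul_assoc, exp_C_mul_derivative (b := b) ⟨d, hy⟩ (by simp [y])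
        ((commute_X _).mul_left rfl)]
  have h0 : z.coeff 0 ∈ h := by
    let f : (Matrix (Fin d) (Fin d) S)[X] →ₐ[ℚ] Matrix (Fin d) (Fin d) S :=
      constantCoeff.toRatAlgHom
    have h1 : f (C a) = a := coeff_C_zero
    have h2 : f y = 0 := coeff_X_mul_zero _
    have h3 : f z = a := by
      rw [hzdef, map_tlog, hudef, map_mul, map_texp, map_texp, h1, h2, texp_zero, mul_one,
        tlog_texp hu (pow_eq_zero_of_mem_strictUpper (hle a ha))]
    change f z ∈ h
    rwa [h3]
  have hcoeff := coeff_mem_of_derivative_exp h hlie ⟨d, hz⟩ hb h0 hd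
  -- Evaluation at `X = 1`, a homomorphism because `1` is central; it sends `z` to the sum of its
  -- coefficients.
  let f : (Matrix (Fin d) (Fin d) S)[X] →ₐ[ℚ] Matrix (Fin d) (Fin d) S :=
    (eval₂RingHom' (RingHom.id _) 1 fun x => Commute.one_right _).toRatAlgHom
  have h1 : f (C a) = a := eval₂_C _ _
  have h2 : f y = b := by
    have hX : f X = 1 := eval₂_X _ _
    have hC : f (C b) = b := eval₂_C _ _
    rw [map_mul, hX, hC, one_mul]
  refine ⟨f z, ?_, ?_⟩
  · have : f z = ∑ i ∈ Finset.range (z.natDegree + 1), z.coeff i := by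
      change eval₂ _ _ z = _
      simp [eval₂_eq_sum_range]
    rw [this]
    exact h.sum_mem fun i _ => hcoeff i
  · rw [← map_texp, hzu, hudef, map_mul, map_texp, map_texp, h1, h2]

end StrictUpper

/-! ### Descent from `K` to `R` by isolation. -/

section Isolated

variable {R K : Type*} [CommRing R] [Field K] [CharZero K] [Algebra R K] {d : ℕ}
  {g : LieSubalgebra R (Matrix (Fin d) (Fin d) R)}

theorem IsIsolated.mem_of_smul_mem [IsDomain R] (hiso : IsIsolated g) {r : R} (hr : r ≠ 0)
    {x : Matrix (Fin d) (Fin d) R} (hx : x ∈ strictUpper R d) (h : r • x ∈ g) : x ∈ g := by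
  have : Module.IsTorsionFree R
    (strictUpper R d ⧸ g.toSubmodule.comap (strictUpper R d).toSubmodule.subtype) := hiso
  have h1 : r • (Submodule.Quotient.mk ⟨x, hx⟩ :
      strictUpper R d ⧸ g.toSubmodule.comap (strictUpper R d).toSubmodule.subtype) = 0 := by
    rw [← Submodule.Quotient.mk_smul, Submodule.Quotient.mk_eq_zero]
    exact h
  have h2 := (smul_eq_zero.1 h1).resolve_left hr
  rw [Submodule.Quotient.mk_eq_zero] at h2
  exact h2

/-- The exponentials of an isolated Lie subalgebra of `𝔫_d(R)` are closed under multiplication if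
`1, …, d - 1` are invertible in `R`. -/
theorem IsIsolated.exists_mem_texp_eq_mul [IsDomain R] [CharZero R]
    (hRK : Function.Injective (algebraMap R K)) (hiso : IsIsolated g)
    (hg : g ≤ strictUpper R d) (hu : UnitsBelow R d) {a b : Matrix (Fin d) (Fin d) R}
    (ha : a ∈ g) (hb : b ∈ g) : ∃ c ∈ g, texp R d c = texp R d a * texp R d b := by
  let ι : Matrix (Fin d) (Fin d) R →ₐ[R] Matrix (Fin d) (Fin d) K :=
    (Algebra.ofId R K).mapMatrix
  have hι : Function.Injective ι := Matrix.map_injective hRK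
  have hιu : ∀ {x}, x ∈ strictUpper R d ↔ ι x ∈ strictUpper K d := by
    refine fun {x} => ⟨map_mem_strictUpper (algebraMap R K), fun h i j hij => ?_⟩
    exact (map_eq_zero_iff _ hRK).1 (h i j hij)
  -- The `ℚ`-span of `g` inside the matrices over `K`, described by clearing denominators.
  let h : Submodule ℚ (Matrix (Fin d) (Fin d) K) :=
    { carrier := {x | ∃ n : ℕ, n ≠ 0 ∧ ∃ y ∈ g, n • x = ι y}
      add_mem' := by
        rintro x x' ⟨n, hn, y, hy, e⟩ ⟨n', hn', y', hy', e'⟩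
        refine ⟨n * n', mul_ne_zero hn hn', n' • y + n • y',
          add_mem (nsmul_mem hy _) (nsmul_mem hy' _), ?_⟩
        rw [map_add, map_nsmul, map_nsmul, ← e, ← e', smul_add, mul_smul, mul_smul,
          smul_comm n n' x]
      zero_mem' := ⟨1, one_ne_zero, 0, zero_mem _, by simp⟩
      smul_mem' := by
        rintro q x ⟨n, hn, y, hy, e⟩
        refine ⟨q.den * n, mul_ne_zero q.den_ne_zero hn, q.num • y, zsmul_mem hy _, ?_⟩
        rw [map_zsmul, ← e, ← Nat.cast_smul_eq_nsmul ℚ, ← Nat.cast_smul_eq_nsmul ℚ n,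
          ← Int.cast_smul_eq_zsmul ℚ, smul_smul, smul_smul, ← Rat.den_mul_eq_num]
        congr 1
        push_cast
        ring }
  have hgh : ∀ {x}, x ∈ g → ι x ∈ h := fun {x} hx => ⟨1, one_ne_zero, x, hx, one_smul _ _⟩
  have hle : ∀ x ∈ h, x ∈ strictUpper K d := by
    rintro x ⟨n, hn, y, hy, e⟩ i j hij
    have h1 := hιu.1 (hg hy) i j hij
    rw [← e, Matrix.smul_apply] at h1
    exact (smul_eq_zero.1 h1).resolve_left hn
  have hlie : ∀ x ∈ h, ∀ y ∈ h, x * y - y * x ∈ h := by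
    rintro x ⟨n, hn, y, hy, e⟩ x' ⟨n', hn', y', hy', e'⟩
    refine ⟨n * n', mul_ne_zero hn hn', ⁅y, y'⁆, g.lie_mem hy hy', ?_⟩
    rw [Ring.lie_def, map_sub, map_mul, map_mul, ← e, ← e', smul_sub, smul_mul_smul_comm,
      smul_mul_smul_comm, mul_comm n' n]
  obtain ⟨c, ⟨n, hn, y, hy, e⟩, hc⟩ :=
    AskZeta.exists_mem_texp_eq_mul h hle hlie (hgh ha) (hgh hb)
  have hcu := hle c ⟨n, hn, y, hy, e⟩
  have hQ : ∀ {x : Matrix (Fin d) (Fin d) K}, x ∈ strictUpper K d → texp ℚ d x = texp R d x := by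
    intro x hx
    have hx := pow_eq_zero_of_mem_strictUpper hx
    rw [texp_eq_exp unitsBelow_rat hx, texp_eq_exp hu hx]
  rw [hQ hcu, hQ (hle _ (hgh ha)), hQ (hle _ (hgh hb)), ← map_texp, ← map_texp, ← map_mul] at hc
  have hprod : texp R d a * texp R d b - 1 ∈ strictUpper R d := mul_sub_one_mem_strictUpper
    (texp_sub_one_mem_strictUpper (hg ha)) (texp_sub_one_mem_strictUpper (hg hb))
  have hcι : ι (tlog R d (texp R d a * texp R d b)) = c := by
    rw [map_tlog, ← hc, tlog_texp hu (pow_eq_zero_of_mem_strictUpper hcu)]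
  -- The logarithm of the product already has entries in `R`, and a nonzero integer multiple of it
  -- lies in `g`.
  refine ⟨_, hiso.mem_of_smul_mem (r := n) (Nat.cast_ne_zero.2 hn) (tlog_mem_strictUpper hprod) ?_,
    texp_tlog hu (pow_eq_zero_of_mem_strictUpper hprod)⟩
  have : (n : R) • tlog R d (texp R d a * texp R d b) = y := by
    apply hι
    rw [Nat.cast_smul_eq_nsmul, map_nsmul, hcι, e]
  rwa [this]

theorem texp_neg_mul_texp (hRK : Function.Injective (algebraMap R K)) (hu : UnitsBelow R d)
    {a : Matrix (Fin d) (Fin d) R} (ha : a ∈ strictUpper R d) :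
    texp R d (-a) * texp R d a = 1 := by
  let ι : Matrix (Fin d) (Fin d) R →ₐ[R] Matrix (Fin d) (Fin d) K :=
    (Algebra.ofId R K).mapMatrix
  have hι : Function.Injective ι := Matrix.map_injective hRK
  have h1 : ι a ^ d = 0 := by rw [← map_pow, pow_eq_zero_of_mem_strictUpper ha, map_zero]
  apply hι
  rw [map_mul, map_one, map_texp, map_texp, map_neg, texp_eq_exp hu h1,
    texp_eq_exp hu (by rw [neg_pow, h1, mul_zero]), IsNilpotent.exp_neg_mul_exp_self ⟨d, h1⟩]

end Isolated
end AskZeta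

/-! ### Averages of kernel sizes and orbit counting. -/

namespace AskZeta

section Counting

theorem card_subtype_prod {X Y : Type*} [Fintype X] [Finite Y] (P : X → Y → Prop) :
    Nat.card {q : X × Y // P q.1 q.2} = ∑ x, Nat.card {y // P x y} := by
  rw [← Nat.card_sigma]
  exact Nat.card_congr
    { toFun := fun q => ⟨q.1.1, q.1.2, q.2⟩
      invFun := fun q => ⟨(q.1, q.2.1), q.2.2⟩
      left_inv := fun _ => rfl
      right_inv := fun _ => rfl }

/-- Averaging over the image of a homomorphism amounts to averaging over the source. -/
theorem inv_card_mul_sum_eq_of_surjective {X Y : Type*} [AddCommGroup X] [AddCommGroup Y]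
    [Fintype X] [Fintype Y] {f : X →+ Y} (hf : Function.Surjective f) (F : Y → ℚ) :
    (Fintype.card Y : ℚ)⁻¹ * ∑ y, F y = (Fintype.card X : ℚ)⁻¹ * ∑ x, F (f x) := by
  classical
  have hfib : ∀ y, (Finset.univ.filter fun x => f x = y).card =
      (Finset.univ.filter fun x => f x = 0).card := fun y =>
    AddMonoidHom.card_fiber_eq_of_mem_range f (hf y) (hf 0)
  set c := (Finset.univ.filter fun x => f x = 0).card
  have hsum : ∀ F : Y → ℚ, ∑ x, F (f x) = c * ∑ y, F y := by
    intro F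
    rw [← Finset.sum_fiberwise Finset.univ f, Finset.mul_sum]
    refine Finset.sum_congr rfl fun y _ => ?_
    rw [Finset.sum_congr rfl fun x hx => congrArg F (Finset.mem_filter.1 hx).2,
      Finset.sum_const, hfib, nsmul_eq_mul]
  have hc : (c : ℚ) ≠ 0 := by
    have : 0 < c := Finset.card_pos.2 ⟨0, by simp⟩
    positivity
  have hX : (Fintype.card X : ℚ) = c * Fintype.card Y := by simpa using hsum fun _ => 1
  rw [hsum, hX, mul_inv]
  field_simp

/-- Fibres of a surjective homomorphism have equal size, so the average may be taken over any
quotient `X` of the parameter module through which `Φ` factors; `hP` itself forces this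
factorization. Summing kernel sizes then counts pairs. -/
theorem ask_range {R M V W X V' : Type*} [CommRing R] [AddCommGroup M] [Module R M]
    [AddCommGroup V] [Module R V] [AddCommGroup W] [Module R W] [AddCommGroup X] [Module R X]
    [Finite X] [Finite V'] (Φ : M →ₗ[R] V →ₗ[R] W) {Ψ : M →ₗ[R] X} (hΨ : Function.Surjective Ψ)
    (e : V ≃ V') (P : X → V' → Prop) (hP : ∀ m v, P (Ψ m) (e v) ↔ Φ m v = 0) :
    ask (LinearMap.range Φ) =
      (Nat.card X : ℚ)⁻¹ * (Nat.card {q : X × V' // P q.1 q.2} : ℚ) := by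
  have hker : LinearMap.ker Ψ ≤ LinearMap.ker Φ.rangeRestrict := by
    intro m hm
    rw [LinearMap.mem_ker] at hm ⊢
    ext v
    have h0 := (hP 0 v).2 (by simp)
    rw [map_zero, ← hm, hP] at h0
    simpa using h0
  let f : X →ₗ[R] LinearMap.range Φ :=
    (LinearMap.ker Ψ).liftQ Φ.rangeRestrict hker ∘ₗ
      (Ψ.quotKerEquivOfSurjective hΨ).symm.toLinearMap
  have hf : ∀ m, f (Ψ m) = Φ.rangeRestrict m := by
    intro m
    have : (Ψ.quotKerEquivOfSurjective hΨ).symm (Ψ m) = Submodule.Quotient.mk m := by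
      rw [LinearEquiv.symm_apply_eq]
      rfl
    simp [f, this]
  have hfs : Function.Surjective f := by
    rintro ⟨_, m, rfl⟩
    exact ⟨Ψ m, hf m⟩
  have := Fintype.ofFinite X
  have : Finite (LinearMap.range Φ) := Finite.of_surjective f hfs
  have := Fintype.ofFinite (LinearMap.range Φ)
  rw [ask, finsum_eq_sum_of_fintype, Nat.card_eq_fintype_card, Nat.card_eq_fintype_card,
    inv_card_mul_sum_eq_of_surjective (f := f.toAddMonoidHom) hfs, card_subtype_prod]
  push_cast
  congr 1
  refine Finset.sum_congr rfl fun x _ => ?_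
  congr 1
  refine Nat.card_congr (e.subtypeEquiv fun v => ?_)
  obtain ⟨m, rfl⟩ := hΨ x
  rw [hP]
  change (f (Ψ m) : V →ₗ[R] W) v = 0 ↔ _
  rw [hf]
  rfl

theorem card_quotient_orbitSetoid_mul_card {S : Type*} [CommRing S] [Finite S] {d : ℕ}
    (H : Subgroup (GL (Fin d) S)) :
    Nat.card (Quotient (orbitSetoid H)) * Nat.card H = Nat.card {q : H × (Fin d → S) //
      Matrix.vecMul q.2 ((q.1 : GL (Fin d) S) : Matrix (Fin d) (Fin d) S) = q.2} := by
  classical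
  -- Inverses turn the right action into a left one; orbits are unchanged and fixed points are
  -- reindexed by inversion.
  let act : MulAction H (Fin d → S) :=
    { smul := fun h x => Matrix.vecMul x (((h⁻¹ : H) : GL (Fin d) S) : Matrix (Fin d) (Fin d) S)
      one_smul := fun x => by
        change Matrix.vecMul x ((((1 : H)⁻¹ : H) : GL (Fin d) S) : Matrix (Fin d) (Fin d) S) = x
        simp
      mul_smul := fun g h x => by
        change Matrix.vecMul x ((((g * h)⁻¹ : H) : GL (Fin d) S) : Matrix (Fin d) (Fin d) S) =
          Matrix.vecMul (Matrix.vecMul x (((h⁻¹ : H) : GL (Fin d) S) : Matrix (Fin d) (Fin d) S))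
            (((g⁻¹ : H) : GL (Fin d) S) : Matrix (Fin d) (Fin d) S)
        rw [Matrix.vecMul_vecMul, mul_inv_rev]
        rfl }
  have hrel : act.orbitRel H (Fin d → S) = orbitSetoid H := by
    refine Setoid.ext fun x y => ?_
    rw [Setoid.comm', MulAction.orbitRel_apply]
    constructor
    · rintro ⟨h, hh⟩
      exact ⟨_, (h⁻¹).2, hh⟩
    · rintro ⟨h, hh, hxy⟩
      refine ⟨⟨h, hh⟩⁻¹, ?_⟩
      change Matrix.vecMul x (((⟨h, hh⟩⁻¹⁻¹ : H) : GL (Fin d) S) : Matrix (Fin d) (Fin d) S) = y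
      rwa [inv_inv]
  have := Fintype.ofFinite H
  have := Fintype.ofFinite (Fin d → S)
  have := Fintype.ofFinite (Quotient (act.orbitRel H (Fin d → S)))
  have key := @MulAction.sum_card_fixedBy_eq_card_orbits_mul_card_group H (Fin d → S) _ act _ _ _
  rw [← hrel, Nat.card_eq_fintype_card, Nat.card_eq_fintype_card, ← key,
    card_subtype_prod (fun (h : H) (x : Fin d → S) =>
      Matrix.vecMul x ((h : GL (Fin d) S) : Matrix (Fin d) (Fin d) S) = x),
    ← Equiv.sum_comp (Equiv.inv H)]
  refine Finset.sum_congr rfl fun h _ => ?_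
  rw [← Nat.card_eq_fintype_card]
  refine Nat.card_congr (Equiv.subtypeEquivRight fun x => ?_)
  change Matrix.vecMul x (((h⁻¹⁻¹ : H) : GL (Fin d) S) : Matrix (Fin d) (Fin d) S) = x ↔ _
  rw [inv_inv]

end Counting

/-! ### Commutation and fixed vectors under exp. -/

section TexpPredicates

variable {R : Type*} [CommRing R] {d : ℕ}

theorem commute_aeval_aeval {A : Type*} [Ring A] [Algebra R A] {a b : A} (h : Commute a b)
    (P Q : R[X]) : Commute (aeval a P) (aeval b Q) := by
  have key : ∀ {a b : A} (P : R[X]), Commute a b → Commute (aeval a P) b := by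
    intro a b P h
    induction P using Polynomial.induction_on' with
    | add p q hp hq => rw [map_add]; exact hp.add_left hq
    | monomial n c =>
      rw [aeval_monomial]
      exact (Algebra.commute_algebraMap_left c b).mul_left (h.pow_left n)
  exact key P (key Q h.symm).symm

theorem commute_texp_iff {A : Type*} [Ring A] [Algebra R A] (hu : UnitsBelow R d) {a b : A}
    (ha : a ^ d = 0) (hb : b ^ d = 0) : Commute (texp R d a) (texp R d b) ↔ Commute a b := by
  refine ⟨fun h => ?_, fun h => commute_aeval_aeval h _ _⟩
  have : Commute (texp R d a - 1) (texp R d b - 1) :=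
    (h.sub_left (Commute.one_left _)).sub_right (Commute.one_right _)
  have := commute_aeval_aeval this (logPoly R d) (logPoly R d)
  change Commute (tlog R d _) (tlog R d _) at this
  rwa [tlog_texp hu ha, tlog_texp hu hb] at this

theorem vecMul_texp_eq_self_iff {S : Type*} [CommRing S] [Algebra R S] (hu : UnitsBelow R d)
    {a : Matrix (Fin d) (Fin d) S} (ha : a ∈ strictUpper S d) (x : Fin d → S) :
    Matrix.vecMul x (texp R d a) = x ↔ Matrix.vecMul x a = 0 := by
  rcases Nat.eq_zero_or_pos d with rfl | hd
  · exact ⟨fun _ => Subsingleton.elim _ _, fun _ => Subsingleton.elim _ _⟩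
  have key : ∀ (b : Matrix (Fin d) (Fin d) S) {P : R[X]}, X ∣ P → Matrix.vecMul x b = 0 →
      Matrix.vecMul x (aeval b P) = 0 := by
    rintro b _ ⟨q, rfl⟩ h
    rw [map_mul, aeval_X, ← Matrix.vecMul_vecMul, h, Matrix.zero_vecMul]
  have h1 : Matrix.vecMul x (texp R d a) = x ↔ Matrix.vecMul x (texp R d a - 1) = 0 := by
    rw [Matrix.vecMul_sub, Matrix.vecMul_one, sub_eq_zero]
  rw [h1]
  constructor
  · intro h
    have := key _ (X_dvd_logPoly (R := R) (d := d)) h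
    change Matrix.vecMul x (tlog R d (texp R d a)) = 0 at this
    rwa [tlog_texp hu (pow_eq_zero_of_mem_strictUpper ha)] at this
  · intro h
    simpa [texp] using key a (X_dvd_expPoly_sub_one hd) h

end TexpPredicates

/-! ### Reduction modulo `𝔓ⁿ`. -/

section Reduction

variable {R : Type*} [CommRing R] [IsLocalRing R] {d : ℕ}

/-- Entrywise reduction of matrices modulo `𝔓ⁿ`. -/
noncomputable def reduceMatrix (R : Type*) [CommRing R] [IsLocalRing R] (d n : ℕ) :
    Matrix (Fin d) (Fin d) R →ₐ[R] Matrix (Fin d) (Fin d) (Quot R n) :=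
  (Algebra.ofId R (Quot R n)).mapMatrix

/-- The image of `g` in the matrices over `R/𝔓ⁿ`. -/
noncomputable def reducedMatrices (g : LieSubalgebra R (Matrix (Fin d) (Fin d) R)) (n : ℕ) :
    Submodule R (Matrix (Fin d) (Fin d) (Quot R n)) :=
  g.toSubmodule.map (reduceMatrix R d n).toLinearMap

/-- The reduction map from `g` onto its image in the matrices over `R/𝔓ⁿ`. -/
noncomputable def toReducedMatrices (g : LieSubalgebra R (Matrix (Fin d) (Fin d) R)) (n : ℕ) :
    g →ₗ[R] reducedMatrices g n :=
  (reduceMatrix R d n).toLinearMap.submoduleMap g.toSubmodule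

theorem coe_toReducedMatrices (g : LieSubalgebra R (Matrix (Fin d) (Fin d) R)) (n : ℕ) (a : g) :
    (toReducedMatrices g n a : Matrix (Fin d) (Fin d) (Quot R n)) = reduceMatrix R d n a := rfl

theorem toReducedMatrices_surjective (g : LieSubalgebra R (Matrix (Fin d) (Fin d) R)) (n : ℕ) :
    Function.Surjective (toReducedMatrices g n) :=
  LinearMap.submoduleMap_surjective _ _

variable {g : LieSubalgebra R (Matrix (Fin d) (Fin d) R)} {G : Subgroup (GL (Fin d) R)} {n : ℕ}

theorem mem_strictUpper_of_mem_reducedMatrices (hg : g ≤ strictUpper R d)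
    {a : Matrix (Fin d) (Fin d) (Quot R n)} (ha : a ∈ reducedMatrices g n) :
    a ∈ strictUpper (Quot R n) d := by
  obtain ⟨b, hb, rfl⟩ := ha
  exact map_mem_strictUpper (algebraMap R (Quot R n)) (hg hb)

/-- Exp is a polynomial over `R`, so it commutes with reduction; the logarithm over `R/𝔓ⁿ` gives
injectivity. -/
theorem exists_texp_equiv (hg : g ≤ strictUpper R d) (hu : UnitsBelow R d)
    (hG : ∀ u : GL (Fin d) R, u ∈ G ↔ ∃ a ∈ g, (u : Matrix (Fin d) (Fin d) R) = texp R d a)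
    (hGg : ∀ a ∈ g, ∃ u : GL (Fin d) R, (u : Matrix (Fin d) (Fin d) R) = texp R d a) (n : ℕ) :
    ∃ E : reducedMatrices g n ≃ congruenceImage G n, ∀ a,
      ((E a : GL (Fin d) (Quot R n)) : Matrix (Fin d) (Fin d) (Quot R n)) =
        texp R d (a : Matrix (Fin d) (Fin d) (Quot R n)) := by
  have hmap : ∀ u : GL (Fin d) R, ((Matrix.GeneralLinearGroup.map
      (Ideal.Quotient.mk (IsLocalRing.maximalIdeal R ^ n)) u : GL (Fin d) (Quot R n)) :
        Matrix (Fin d) (Fin d) (Quot R n)) = reduceMatrix R d n u := fun u => rfl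
  have h1 : ∀ a : reducedMatrices g n, ∃ u : congruenceImage G n,
      ((u : GL (Fin d) (Quot R n)) : Matrix (Fin d) (Fin d) (Quot R n)) =
        texp R d (a : Matrix (Fin d) (Fin d) (Quot R n)) := by
    rintro ⟨_, a, ha, rfl⟩
    obtain ⟨u, hua⟩ := hGg a ha
    refine ⟨⟨_, u, (hG u).2 ⟨a, ha, hua⟩, rfl⟩, ?_⟩
    change reduceMatrix R d n u = _
    rw [hua, map_texp]
    rfl
  choose E hE using h1
  refine ⟨Equiv.ofBijective E ⟨fun a b hab => ?_, ?_⟩, hE⟩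
  · have h2 : texp R d (a : Matrix (Fin d) (Fin d) (Quot R n)) =
        texp R d (b : Matrix (Fin d) (Fin d) (Quot R n)) := by
      rw [← hE, ← hE, hab]
    have h3 := congrArg (tlog R d) h2
    rw [tlog_texp hu (pow_eq_zero_of_mem_strictUpper
      (mem_strictUpper_of_mem_reducedMatrices hg a.2)),
      tlog_texp hu (pow_eq_zero_of_mem_strictUpper
      (mem_strictUpper_of_mem_reducedMatrices hg b.2))] at h3
    exact Subtype.ext h3
  · rintro ⟨_, u, hu, rfl⟩
    obtain ⟨a, ha, hua⟩ := (hG u).1 hu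
    refine ⟨⟨_, a, ha, rfl⟩, ?_⟩
    refine Subtype.ext (Units.ext ?_)
    rw [hE]
    change texp R d (reduceMatrix R d n a) = reduceMatrix R d n u
    rw [hua, map_texp]

theorem ask_reduction_rowAction [Finite (Quot R n)] :
    ask (reduction (g.toSubmodule.map (rowAction R d d)) n) =
      (Nat.card (reducedMatrices g n) : ℚ)⁻¹ * (Nat.card {q : reducedMatrices g n × (Fin d → Quot R n) //
        Matrix.vecMul q.2 (q.1 : Matrix (Fin d) (Fin d) (Quot R n)) = 0} : ℚ) := by
  let Φ := LinearMap.rTensorHom (Quot R n) ∘ₗ rowAction R d d ∘ₗ g.toSubmodule.subtype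
  have hr : reduction (g.toSubmodule.map (rowAction R d d)) n = LinearMap.range Φ := by
    rw [reduction, LinearMap.range_comp, LinearMap.range_comp, Submodule.range_subtype]
  let e : (Fin d → R) ⊗[R] Quot R n ≃ₗ[R] (Fin d → Quot R n) :=
    TensorProduct.comm R _ _ ≪≫ₗ TensorProduct.piScalarRight R R (Quot R n) (Fin d)
  have he : ∀ a v, e (Φ a v) = Matrix.vecMul (e v) (reduceMatrix R d n a) := by
    intro a v
    induction v with
    | zero => simp
    | add v w hv hw => rw [map_add, map_add, hv, hw, map_add, Matrix.add_vecMul]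
    | tmul v s =>
      ext j
      simp [e, Φ, reduceMatrix, rowAction, Matrix.vecMul, dotProduct, Algebra.smul_def,
        Algebra.ofId_apply, Finset.sum_mul, mul_right_comm]
  rw [hr]
  refine ask_range Φ (toReducedMatrices_surjective g n) e.toEquiv
    (fun a x => Matrix.vecMul x (a : Matrix (Fin d) (Fin d) (Quot R n)) = 0) fun a v => ?_
  rw [coe_toReducedMatrices, ← e.map_eq_zero_iff, he]
  rfl

open scoped Pointwise in
-- An element of `g` with all entries divisible by `r` is `r` times a strictly upper triangular
-- matrix, which isolation puts in `g`. Hence `g ⊗ R/𝔓ⁿ` is the matrix image of `g`.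
theorem ker_toReducedMatrices [IsDomain R] (hg : g ≤ strictUpper R d) (hiso : IsIsolated g)
    {r : R} (hr : r ≠ 0) (hn : IsLocalRing.maximalIdeal R ^ n = Ideal.span {r}) :
    LinearMap.ker (toReducedMatrices g n) =
      (IsLocalRing.maximalIdeal R ^ n) • (⊤ : Submodule R g) := by
  have htop : (IsLocalRing.maximalIdeal R ^ n) • (⊤ : Submodule R g) = r • ⊤ := by
    rw [hn, Submodule.ideal_span_singleton_smul]
  ext b
  rw [htop, LinearMap.mem_ker, Submodule.mem_smul_pointwise_iff_exists, ← Subtype.coe_inj,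
    coe_toReducedMatrices]
  constructor
  · intro h
    have h1 : ∀ i j, ∃ c : R, (b : Matrix (Fin d) (Fin d) R) i j = r * c := by
      intro i j
      have h2 : Ideal.Quotient.mk (IsLocalRing.maximalIdeal R ^ n)
        ((b : Matrix (Fin d) (Fin d) R) i j) = 0 := congrFun (congrFun h i) j
      rwa [Ideal.Quotient.eq_zero_iff_mem, hn, Ideal.mem_span_singleton] at h2
    choose c hc using h1
    have hbc : r • (Matrix.of c) = (b : Matrix (Fin d) (Fin d) R) := by
      ext i j
      simp [hc]
    have hcu : Matrix.of c ∈ strictUpper R d := by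
      intro i j hij
      have := hg b.2 i j hij
      rw [hc] at this
      exact (mul_eq_zero.1 this).resolve_left hr
    exact ⟨⟨_, hiso.mem_of_smul_mem hr hcu (hbc ▸ b.2)⟩, trivial, Subtype.ext hbc⟩
  · rintro ⟨c, -, rfl⟩
    ext i j
    change Ideal.Quotient.mk (IsLocalRing.maximalIdeal R ^ n)
        (r * (c : Matrix (Fin d) (Fin d) R) i j) = 0
    rw [Ideal.Quotient.eq_zero_iff_mem, hn, Ideal.mem_span_singleton]
    exact dvd_mul_right _ _

theorem ask_reduction_adModule [Finite (Quot R n)]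
    (hker : LinearMap.ker (toReducedMatrices g n) =
      (IsLocalRing.maximalIdeal R ^ n) • (⊤ : Submodule R g)) :
    ask (reduction (adModule R g) n) = (Nat.card (reducedMatrices g n) : ℚ)⁻¹ *
      (Nat.card {q : reducedMatrices g n × reducedMatrices g n //
        Commute (q.1 : Matrix (Fin d) (Fin d) (Quot R n)) q.2} : ℚ) := by
  let Φ := LinearMap.rTensorHom (Quot R n) ∘ₗ
    ((LieAlgebra.ad R g : g →ₗ[R] g →ₗ[R] g).flip)
  have hr : reduction (adModule R g) n = LinearMap.range Φ := by
    rw [reduction, LinearMap.range_comp, adModule]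
  let q := TensorProduct.tensorQuotEquivQuotSMul g (IsLocalRing.maximalIdeal R ^ n)
  let e : g ⊗[R] Quot R n ≃ₗ[R] reducedMatrices g n :=
    q ≪≫ₗ Submodule.quotEquivOfEq _ _ hker.symm ≪≫ₗ
      (toReducedMatrices g n).quotKerEquivOfSurjective (toReducedMatrices_surjective g n)
  have hq : ∀ b : g, q (b ⊗ₜ 1) = Submodule.Quotient.mk b := fun b => by
    rw [← LinearEquiv.eq_symm_apply]
    exact (TensorProduct.tensorQuotEquivQuotSMul_symm_mk _ b).symm
  have he : ∀ b : g, e (b ⊗ₜ 1) = toReducedMatrices g n b := fun b => by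
    change (toReducedMatrices g n).quotKerEquivOfSurjective (toReducedMatrices_surjective g n)
      (Submodule.quotEquivOfEq _ _ hker.symm (q (b ⊗ₜ 1))) = _
    rw [hq]
    rfl
  rw [hr]
  have : Finite (reducedMatrices g n) := inferInstance
  refine ask_range Φ (toReducedMatrices_surjective g n) e.toEquiv
    (fun a x => Commute (a : Matrix (Fin d) (Fin d) (Quot R n)) x) fun a v => ?_
  -- Every element of `g ⊗ R/𝔓ⁿ` is a pure tensor `b ⊗ 1`, on which `Φ a` is the bracket with `a`.
  obtain ⟨w, rfl⟩ := q.symm.surjective v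
  obtain ⟨b, rfl⟩ := Submodule.Quotient.mk_surjective _ w
  have hb : q.symm (Submodule.Quotient.mk b) = b ⊗ₜ 1 := by
    rw [LinearEquiv.symm_apply_eq, hq]
  have hΦ : Φ a (b ⊗ₜ 1) = ⁅b, a⁆ ⊗ₜ 1 := rfl
  rw [hb, hΦ, ← e.map_eq_zero_iff, he]
  change Commute _ ((e (b ⊗ₜ 1) : reducedMatrices g n) : Matrix (Fin d) (Fin d) (Quot R n)) ↔ _
  rw [he, ← Subtype.coe_inj, coe_toReducedMatrices, coe_toReducedMatrices, coe_toReducedMatrices,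
    LieSubalgebra.coe_bracket, Ring.lie_def, map_sub, map_mul, map_mul, ZeroMemClass.coe_zero,
    sub_eq_zero]
  exact ⟨fun h => h.eq.symm, fun h => h.symm⟩

end Reduction
end AskZeta

/-! ### Comparing zeta functions coefficientwise. -/

namespace AskZeta
section ZetaFunctions

variable {R : Type*} [CommRing R] [IsLocalRing R] {d : ℕ}
  {g : LieSubalgebra R (Matrix (Fin d) (Fin d) R)} {G : Subgroup (GL (Fin d) R)}

theorem orbitZeta_eq_matrixAskZeta (hfin : ∀ n, Finite (Quot R n)) (hg : g ≤ strictUpper R d)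
    (hu : UnitsBelow R d)
    (hG : ∀ u : GL (Fin d) R, u ∈ G ↔ ∃ a ∈ g, (u : Matrix (Fin d) (Fin d) R) = texp R d a)
    (hGg : ∀ a ∈ g, ∃ u : GL (Fin d) R, (u : Matrix (Fin d) (Fin d) R) = texp R d a) :
    orbitZeta G = matrixAskZeta g.toSubmodule := by
  ext n
  have := hfin n
  obtain ⟨E, hE⟩ := exists_texp_equiv hg hu hG hGg n
  simp only [orbitZeta, matrixAskZeta, askZeta, PowerSeries.coeff_mk]
  have hcard : (Nat.card (reducedMatrices g n) : ℚ) ≠ 0 :=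
    Nat.cast_ne_zero.2 Nat.card_pos.ne'
  rw [ask_reduction_rowAction, eq_inv_mul_iff_mul_eq₀ hcard, mul_comm, Nat.card_congr E,
    ← Nat.cast_mul, card_quotient_orbitSetoid_mul_card]
  congr 1
  refine (Nat.card_congr ((E.prodCongr (Equiv.refl _)).subtypeEquiv fun q => ?_)).symm
  rw [← vecMul_texp_eq_self_iff hu (mem_strictUpper_of_mem_reducedMatrices hg q.1.2), ← hE]
  rfl

theorem conjZeta_eq_askZeta [IsDomain R] (hfin : ∀ n, Finite (Quot R n))
    (hprin : ∀ n, ∃ r : R, r ≠ 0 ∧ IsLocalRing.maximalIdeal R ^ n = Ideal.span {r})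
    (hg : g ≤ strictUpper R d) (hiso : IsIsolated g) (hu : UnitsBelow R d)
    (hG : ∀ u : GL (Fin d) R, u ∈ G ↔ ∃ a ∈ g, (u : Matrix (Fin d) (Fin d) R) = texp R d a)
    (hGg : ∀ a ∈ g, ∃ u : GL (Fin d) R, (u : Matrix (Fin d) (Fin d) R) = texp R d a) :
    conjZeta G = askZeta (adModule R g) := by
  ext n
  have := hfin n
  obtain ⟨r, hr, hrn⟩ := hprin n
  obtain ⟨E, hE⟩ := exists_texp_equiv hg hu hG hGg n
  simp only [conjZeta, askZeta, PowerSeries.coeff_mk]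
  have hcard : (Nat.card (reducedMatrices g n) : ℚ) ≠ 0 :=
    Nat.cast_ne_zero.2 Nat.card_pos.ne'
  rw [ask_reduction_adModule (ker_toReducedMatrices hg hiso hr hrn),
    eq_inv_mul_iff_mul_eq₀ hcard, mul_comm, Nat.card_congr E, ← Nat.cast_mul,
    ← card_comm_eq_card_conjClasses_mul_card]
  congr 1
  refine (Nat.card_congr ((E.prodCongr E).subtypeEquiv fun q => ?_)).symm
  have hnil : ∀ a : reducedMatrices g n, (a : Matrix (Fin d) (Fin d) (Quot R n)) ^ d = 0 :=
    fun a => pow_eq_zero_of_mem_strictUpper (mem_strictUpper_of_mem_reducedMatrices hg a.2)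
  rw [← commute_texp_iff hu (hnil _) (hnil _), ← hE, ← hE]
  exact ⟨fun h => Subtype.ext (Units.ext h.eq),
    fun h => congrArg (fun u : congruenceImage G n =>
      ((u : GL (Fin d) (Quot R n)) : Matrix (Fin d) (Fin d) (Quot R n))) h⟩

end ZetaFunctions
end AskZeta

/-! ### The group `exp(𝔤)` and the theorem. -/

theorem mainTheorem4 (p : ℕ) [Fact p.Prime] (K : Type*) [Field K] [Algebra ℚ_[p] K]
    [FiniteDimensional ℚ_[p] K] (d : ℕ) (hpd : d ≤ p)
    (g : LieSubalgebra (AskZeta.valuationRing p K)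
      (Matrix (Fin d) (Fin d) (AskZeta.valuationRing p K)))
    (hg : g ≤ AskZeta.strictUpper (AskZeta.valuationRing p K) d)
    (hiso : AskZeta.IsIsolated g) :
    ∃ G : Subgroup (GL (Fin d) (AskZeta.valuationRing p K)),
      -- `G = exp(g)`, as sets of matrices over `K`
      (fun u : GL (Fin d) (AskZeta.valuationRing p K) =>
          (u : Matrix (Fin d) (Fin d) (AskZeta.valuationRing p K)).map
            (algebraMap (AskZeta.valuationRing p K) K)) '' (G : Set _) =
        (fun a : Matrix (Fin d) (Fin d) (AskZeta.valuationRing p K) =>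
          AskZeta.matrixExp p K (a.map (algebraMap (AskZeta.valuationRing p K) K))) ''
            (g : Set _) ∧
      -- `G` consists of upper unitriangular matrices
      (∀ u ∈ G, (∀ i, u i i = 1) ∧ ∀ i j, j < i → u i j = 0) ∧
      AskZeta.orbitZeta G = AskZeta.matrixAskZeta g.toSubmodule ∧
      AskZeta.conjZeta G = AskZeta.askZeta (AskZeta.adModule (AskZeta.valuationRing p K) g) := by
  have : CharZero K := charZero_of_injective_algebraMap (algebraMap ℚ_[p] K).injective
  have hOK : Function.Injective (algebraMap (valuationRing p K) K) := Subtype.val_injective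
  have : CharZero (valuationRing p K) := ⟨fun m n h => Nat.cast_injective (R := K) (by
    simpa using congrArg (algebraMap (valuationRing p K) K) h)⟩
  have hu : UnitsBelow (valuationRing p K) d := fun i h0 hi =>
    isUnit_natCast_of_lt p K h0 (hi.trans_le hpd)
  have hinv : ∀ a ∈ g, texp (valuationRing p K) d (-a) * texp (valuationRing p K) d a = 1 :=
    fun a ha => texp_neg_mul_texp hOK hu (hg ha)
  have hGg : ∀ a ∈ g, ∃ u : GL (Fin d) (valuationRing p K),
      (u : Matrix (Fin d) (Fin d) (valuationRing p K)) = texp (valuationRing p K) d a :=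
    fun a ha => ⟨⟨texp (valuationRing p K) d a, texp (valuationRing p K) d (-a),
      by simpa using hinv (-a) (neg_mem ha), hinv a ha⟩, rfl⟩
  let G : Subgroup (GL (Fin d) (valuationRing p K)) :=
    { carrier := {u | ∃ a ∈ g,
        (u : Matrix (Fin d) (Fin d) (valuationRing p K)) = texp (valuationRing p K) d a}
      mul_mem' := by
        rintro u v ⟨a, ha, hua⟩ ⟨b, hb, hvb⟩
        obtain ⟨c, hc, h⟩ := hiso.exists_mem_texp_eq_mul hOK hg hu ha hb
        exact ⟨c, hc, by rw [Units.val_mul, hua, hvb, h]⟩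
      one_mem' := ⟨0, zero_mem _, by rw [texp_zero, Units.val_one]⟩
      inv_mem' := by
        rintro u ⟨a, ha, hua⟩
        refine ⟨-a, neg_mem ha, ?_⟩
        exact Units.inv_eq_of_mul_eq_one_left (by rw [hua, hinv a ha]) }
  have hG : ∀ u : GL (Fin d) (valuationRing p K), u ∈ G ↔
      ∃ a ∈ g, (u : Matrix (Fin d) (Fin d) (valuationRing p K)) = texp (valuationRing p K) d a :=
    fun _ => Iff.rfl
  have hexp : ∀ a ∈ g, matrixExp p K (a.map (algebraMap (valuationRing p K) K)) =
      (texp (valuationRing p K) d a).map (algebraMap (valuationRing p K) K) := by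
    intro a ha
    have h1 : (a.map (algebraMap (valuationRing p K) K)) ^ d = 0 :=
      pow_eq_zero_of_mem_strictUpper (map_mem_strictUpper _ (hg ha))
    rw [matrixExp, ← texp_eq_exp hu h1]
    exact (map_texp (Algebra.ofId (valuationRing p K) K).mapMatrix a).symm
  refine ⟨G, ?_, ?_, orbitZeta_eq_matrixAskZeta (finite_quot p K) hg hu hG hGg,
    conjZeta_eq_askZeta (finite_quot p K) (exists_maximalIdeal_pow_eq_span p K) hg hiso hu hG hGg⟩
  · ext x
    constructor
    · rintro ⟨u, ⟨a, ha, hua⟩, rfl⟩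
      exact ⟨a, ha, by simp only [hexp a ha, hua]⟩
    · rintro ⟨a, ha, rfl⟩
      obtain ⟨u, hua⟩ := hGg a ha
      exact ⟨u, ⟨a, ha, hua⟩, by simp only [hexp a ha, hua]⟩
  · rintro u ⟨a, ha, hua⟩
    have h := texp_sub_one_mem_strictUpper (R := (valuationRing p K)) (hg ha)
    rw [← hua] at h
    refine ⟨fun i => ?_, fun i j hij => ?_⟩
    · simpa [sub_eq_zero] using h i i le_rfl
    · simpa [hij.ne'] using h i j hij.le
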